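/- Let $g:\mathbb{R}\to\mathbb{R}$ be a continuous function that extends to an entire function on $\mathbb{C}$, and let $\Lambda\subseteq\mathbb{R}$ have a finite accumulation point, i.e. there are distinct $\lambda_n\in\Lambda$ and $\lambda^*\in\mathbb{R}$ with $\lambda_n\to\lambda^*$. Let $a<b$ be real, let $C[a,b]$ be the space of continuous real-valued functions on $[a,b]$ with the uniform norm, and put $$\mathcal{M}_\Lambda=\operatorname{span}\{x\mapsto g(\lambda x):\lambda\in\Lambda\}\subseteq C[a,b],\qquad N_g=\{n\in\mathbb{Z}_{\ge 0}: g^{(n)}(0)\neq 0\}.$$ Then: (i) if $[a,b]\subseteq(0,\infty)$ or $[a,b]\subseteq(-\infty,0)$, then $\mathcal{M}_\Lambda$ is dense in $C[a,b]$ if and only if $$\sum_{n\in N_g\setminus\{0\}}\frac1n=\infty;$$ (ii) if $a=0$ or $b=0$, then $\mathcal{M}_\Lambda$ is dense in $C[a,b]$ if and only if $0\in N_g$ and $$\sum_{n\in N_g\setminus\{0\}}\frac1n=\infty;$$ (iii) if $a<0<b$, then $\mathcal{M}_\Lambda$ is dense in $C[a,b]$ if and only if $0\in N_g$ and $$\sum_{\substack{n\in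 N_g\setminus\{0\}\\ n\text{ even}}}\frac1n=\sum_{\substack{n\in N_g\\ n\text{ odd}}}\frac1n=\infty.$$ -/

import Mathlib

/-- `g` is the restriction to the real line of an entire function. -/
def HasEntireExtension (g : C(ℝ, ℝ)) : Prop :=
  ∃ G : ℂ → ℂ, Differentiable ℂ G ∧ ∀ x : ℝ, G (x : ℂ) = (g x : ℂ)

/-- The function `x ↦ g (t * x)` on `[a, b]`. -/
def dilate (g : C(ℝ, ℝ)) (a b t : ℝ) : C(Set.Icc a b, ℝ) where
  toFun x := g (t * (x : ℝ))
  continuous_toFun := by fun_prop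

/-- The span in `C[a, b]` of the functions `x ↦ g (t * x)`, `t ∈ Λ`. -/
def dilateSpan (g : C(ℝ, ℝ)) (Λ : Set ℝ) (a b : ℝ) : Submodule ℝ C(Set.Icc a b, ℝ) :=
  Submodule.span ℝ {f | ∃ t ∈ Λ, f = dilate g a b t}

/-- The set of `n` for which the `n`-th derivative of `g` at `0` is nonzero. -/
def derivSupport (g : C(ℝ, ℝ)) : Set ℕ :=
  {n | iteratedDeriv n g 0 ≠ 0}

/-- `∑_{n ∈ S} 1 / n = ∞`, a series of nonnegative terms; used only for sets `S` without `0`. -/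
def ReciprocalSumDiverges (S : Set ℕ) : Prop :=
  ¬ Summable fun n : S => 1 / ((n : ℕ) : ℝ)

/-! Density is tested by duality. For a functional `φ` on `C[a,b]`, the map `t ↦ φ (g (t ·))` is an
everywhere convergent power series with coefficients `g⁽ⁿ⁾(0)/n! · φ(xⁿ)`. If it vanishes on `Λ`,
which accumulates, it vanishes identically, so `φ(xⁿ) = 0` for every `n` in `derivSupport g`. The
dilates and these monomials thus have the same annihilator
(`HasEntireExtension.dense_dilateSpan_iff`), and Müntz's theorem with natural exponents remains.

Sufficiency: von Golitschek's product bound `∏ |1 - m/k|` tends to `0` when `∑ 1/k` diverges. This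
gives every `x ^ m`, `m > 0`, on `[0, c]`; signs transfer it to other intervals, separately for even
and odd exponents if `0` is interior, and Weierstrass concludes.

Necessity: density lets `x⁻¹` be approximated on some `[c, d]` with `c > 0`. On a geometric grid `a
r ^ j` each `x ^ n` is a geometric sequence of ratio `r ^ n`. A product of contractive polynomials
in the cyclic shift kills all sequences with `n` in the support, away from a short wrap-around
block, but keeps a definite part of `x⁻¹`. Its degree is controlled by `∑ 1/n`, so a small sum keeps
the error away from `0` (`div_sq_le_of_abs_inv_sub_eval_le`). A convergent series reduces to a small
sum by deleting finitely many exponents. -/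

open Polynomial

/-! ### Contractive polynomials in an isometry -/

section Isometry

variable {H : Type*} [NormedAddCommGroup H] [InnerProductSpace ℝ H]

/-- The polynomial `((1 + z + ⋯ + z ^ (m - 1)) / m) * ((1 + z ^ m) / 2) * ((q - z) / (q - 1))`. -/
noncomputable def annihilatorPoly (q : ℝ) (m : ℕ) : ℝ[X] :=
  (C (m : ℝ)⁻¹ * ∑ j ∈ Finset.range m, X ^ j) * (C (2 : ℝ)⁻¹ * (1 + X ^ m)) *
    (C (q - 1)⁻¹ * (C q - X))

lemma norm_sq_smul_sub_apply (U : H →ₗᵢ[ℝ] H) (q : ℝ) (f : H) :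
    ‖q • f - U f‖ ^ 2 = (q - 1) ^ 2 * ‖f‖ ^ 2 + q * ‖U f - f‖ ^ 2 := by
  rw [norm_sub_sq_real, norm_sub_sq_real, U.norm_map, norm_smul, inner_smul_left,
    real_inner_comm, mul_pow, Real.norm_eq_abs, sq_abs]
  simp only [conj_trivial]
  ring

lemma norm_pow_apply (U : H →ₗᵢ[ℝ] H) (k : ℕ) (f : H) :
    ‖(U.toLinearMap ^ k) f‖ = ‖f‖ := by
  induction k with
  | zero => simp
  | succ k ih => rw [pow_succ', Module.End.mul_apply]; simpa using ih

lemma norm_aeval_mean_le (U : H →ₗᵢ[ℝ] H) (m : ℕ) (f : H) :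
    ‖aeval U.toLinearMap (C (m : ℝ)⁻¹ * ∑ j ∈ Finset.range m, X ^ j : ℝ[X]) f‖ ≤ ‖f‖ := by
  rcases Nat.eq_zero_or_pos m with rfl | hm
  · simp
  have h : aeval U.toLinearMap (C (m : ℝ)⁻¹ * ∑ j ∈ Finset.range m, X ^ j : ℝ[X]) f
      = (m : ℝ)⁻¹ • ∑ j ∈ Finset.range m, (U.toLinearMap ^ j) f := by
    simp [map_mul, map_sum, Module.End.mul_apply, LinearMap.sum_apply,
      Module.algebraMap_end_apply, Finset.smul_sum]
  have hm' : (0 : ℝ) < m := by exact_mod_cast hm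
  rw [h, norm_smul, norm_inv, Real.norm_natCast]
  have h2 : ‖∑ j ∈ Finset.range m, (U.toLinearMap ^ j) f‖ ≤ m * ‖f‖ := by
    refine (norm_sum_le _ _).trans ?_
    simp [norm_pow_apply]
  calc (m : ℝ)⁻¹ * ‖∑ j ∈ Finset.range m, (U.toLinearMap ^ j) f‖
      ≤ (m : ℝ)⁻¹ * (m * ‖f‖) := by gcongr
    _ = ‖f‖ := by field_simp

/-- The factor `q - z` alone has norm up to `q + 1`; by `norm_sq_smul_sub_apply` the excess over `q
- 1` comes from `U g - g`. Averaging telescopes this difference to size `‖u - f‖ / m`, while `‖g‖ ≤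
‖f + u‖ / 2`, where `u = U ^ m f`. The parallelogram law balances the two exactly when `q / m ^ 2 ≤
(q - 1) ^ 2 / 4`. -/
lemma norm_aeval_annihilatorPoly_le (U : H →ₗᵢ[ℝ] H) {q : ℝ} (hq : 1 < q) {m : ℕ} (hm : 0 < m)
    (hqm : 4 * q ≤ (m * (q - 1)) ^ 2) (f : H) :
    ‖aeval U.toLinearMap (annihilatorPoly q m) f‖ ≤ ‖f‖ := by
  set A : ℝ[X] := C (m : ℝ)⁻¹ * ∑ j ∈ Finset.range m, X ^ j with hA
  set B : ℝ[X] := C (2 : ℝ)⁻¹ * (1 + X ^ m) with hB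
  set T := U.toLinearMap
  have hm' : (0 : ℝ) < m := by exact_mod_cast hm
  have hq' : 0 < q - 1 := by linarith
  set g := aeval T (A * B) f with hg
  set u := (T ^ m) f with hu
  have hgB : g = aeval T A ((2 : ℝ)⁻¹ • (f + u)) := by
    rw [hg, map_mul, Module.End.mul_apply]
    congr 1
    simp [hB, hu, T, Module.algebraMap_end_apply]
  have h1 : ‖g‖ ^ 2 ≤ ‖f + u‖ ^ 2 / 4 := by
    have : ‖g‖ ≤ 2⁻¹ * ‖f + u‖ := by
      rw [hgB]
      refine (norm_aeval_mean_le U m _).trans ?_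
      rw [norm_smul]; norm_num
    calc ‖g‖ ^ 2 ≤ (2⁻¹ * ‖f + u‖) ^ 2 := by gcongr
      _ = _ := by ring
  have hnu : ‖u‖ = ‖f‖ := norm_pow_apply U m f
  have hpar : ‖f + u‖ ^ 2 + ‖u - f‖ ^ 2 = 4 * ‖f‖ ^ 2 := by
    rw [norm_add_sq_real, norm_sub_sq_real, hnu, real_inner_comm]; ring
  have hdiff : U g - g = (m : ℝ)⁻¹ • ((2 : ℝ)⁻¹ • ((T ^ m) (u - f) + (u - f))) := by
    have hp : (X - 1) * (A * B) = C (m : ℝ)⁻¹ * (C (2 : ℝ)⁻¹ * ((X ^ m + 1) * (X ^ m - 1))) := by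
      rw [← mul_geom_sum, hA, hB]; ring
    have h2 : U g - g = aeval T ((X - 1) * (A * B)) f := by
      rw [map_mul, Module.End.mul_apply, ← hg]; simp [T]
    rw [h2, hp]
    simp [hu, T, Module.algebraMap_end_apply, Module.End.mul_apply]
    rw [smul_comm]
  have h3 : ‖U g - g‖ ^ 2 ≤ ‖u - f‖ ^ 2 / m ^ 2 := by
    have : ‖U g - g‖ ≤ (m : ℝ)⁻¹ * ‖u - f‖ := by
      rw [hdiff, norm_smul, norm_smul, norm_inv, Real.norm_natCast]
      gcongr
      have := norm_add_le ((T ^ m) (u - f)) (u - f)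
      rw [norm_pow_apply U m] at this
      rw [Real.norm_of_nonneg (by norm_num)]
      linarith
    calc ‖U g - g‖ ^ 2 ≤ ((m : ℝ)⁻¹ * ‖u - f‖) ^ 2 := by gcongr
      _ = _ := by field_simp
  have hval : aeval T (annihilatorPoly q m) f = (q - 1)⁻¹ • (q • g - U g) := by
    have : annihilatorPoly q m = (C (q - 1)⁻¹ * (C q - X)) * (A * B) := by
      rw [annihilatorPoly]; ring
    rw [this, map_mul, Module.End.mul_apply, ← hg]
    simp [T, Module.algebraMap_end_apply]
  have h4 := norm_sq_smul_sub_apply U q g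
  have h5 : q * (‖u - f‖ ^ 2 / m ^ 2) ≤ (q - 1) ^ 2 * (‖u - f‖ ^ 2 / 4) := by
    have : q * (‖u - f‖ ^ 2 / m ^ 2) = (4 * q) * (‖u - f‖ ^ 2 / (4 * m ^ 2)) := by field_simp
    rw [this]
    calc (4 * q) * (‖u - f‖ ^ 2 / (4 * m ^ 2))
        ≤ (m * (q - 1)) ^ 2 * (‖u - f‖ ^ 2 / (4 * m ^ 2)) := by gcongr
      _ = _ := by field_simp
  have h6 : ‖q • g - U g‖ ^ 2 ≤ ((q - 1) * ‖f‖) ^ 2 := by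
    rw [h4]
    have e1 : (q - 1) ^ 2 * ‖g‖ ^ 2 ≤ (q - 1) ^ 2 * (‖f + u‖ ^ 2 / 4) := by gcongr
    have e2 : q * ‖U g - g‖ ^ 2 ≤ q * (‖u - f‖ ^ 2 / m ^ 2) := by gcongr
    have e3 : (q - 1) ^ 2 * (‖f + u‖ ^ 2 / 4) + (q - 1) ^ 2 * (‖u - f‖ ^ 2 / 4)
        = ((q - 1) * ‖f‖) ^ 2 := by
      rw [mul_pow]; linear_combination (q - 1) ^ 2 / 4 * hpar
    linarith
  have h7 : ‖q • g - U g‖ ≤ (q - 1) * ‖f‖ := le_of_sq_le_sq h6 (by positivity)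
  rw [hval, norm_smul, norm_inv, Real.norm_of_nonneg hq'.le]
  rw [inv_mul_le_iff₀ hq']
  exact h7

end Isometry

lemma natDegree_annihilatorPoly_le (q : ℝ) (m : ℕ) :
    (annihilatorPoly q m).natDegree ≤ 2 * m := by
  rcases Nat.eq_zero_or_pos m with rfl | hm
  · simp [annihilatorPoly]
  have h1 : (∑ j ∈ Finset.range m, X ^ j : ℝ[X]).natDegree ≤ m - 1 := by
    refine natDegree_sum_le_of_forall_le _ _ fun j hj => ?_
    rw [natDegree_X_pow]
    have := Finset.mem_range.1 hj
    omega
  have h2 : (1 + X ^ m : ℝ[X]).natDegree ≤ m := by compute_degree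
  have h3 : (C q - X : ℝ[X]).natDegree ≤ 1 := by compute_degree
  unfold annihilatorPoly
  refine natDegree_mul_le.trans ?_
  refine (add_le_add natDegree_mul_le (natDegree_C_mul_le _ _)).trans ?_
  have h4 := natDegree_C_mul_le (m : ℝ)⁻¹ (∑ j ∈ Finset.range m, X ^ j : ℝ[X])
  have h5 := natDegree_C_mul_le (2 : ℝ)⁻¹ (1 + X ^ m : ℝ[X])
  omega

lemma eval_annihilatorPoly_self (q : ℝ) (m : ℕ) : (annihilatorPoly q m).eval q = 0 := by
  simp [annihilatorPoly]

lemma le_eval_annihilatorPoly {q z : ℝ} (hq : 1 < q) (hz0 : 0 < z) (hz1 : z ≤ 1) {m : ℕ}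
    (hm : 0 < m) : z ^ (2 * m) ≤ (annihilatorPoly q m).eval z := by
  have hm' : (0 : ℝ) < m := by exact_mod_cast hm
  have e : (annihilatorPoly q m).eval z = ((m : ℝ)⁻¹ * ∑ j ∈ Finset.range m, z ^ j) *
      (2⁻¹ * (1 + z ^ m)) * ((q - 1)⁻¹ * (q - z)) := by
    simp [annihilatorPoly, eval_finsetSum]
  have h1 : z ^ m ≤ (m : ℝ)⁻¹ * ∑ j ∈ Finset.range m, z ^ j := by
    rw [le_inv_mul_iff₀ hm']
    calc (m : ℝ) * z ^ m = ∑ j ∈ Finset.range m, z ^ m := by simp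
      _ ≤ _ := Finset.sum_le_sum fun j hj =>
        pow_le_pow_of_le_one hz0.le hz1 (Finset.mem_range.1 hj).le
  have h2 : z ^ m ≤ 2⁻¹ * (1 + z ^ m) := by
    have := pow_le_one₀ (n := m) hz0.le hz1
    linarith
  have h3 : 1 ≤ (q - 1)⁻¹ * (q - z) := by
    rw [le_inv_mul_iff₀ (by linarith)]; linarith
  rw [e]
  calc z ^ (2 * m) = z ^ m * z ^ m * 1 := by ring
    _ ≤ _ := by gcongr

/-! ### The cyclic shift and geometric sequences -/

/-- The cyclic shift on functions on `ℤ / M`. -/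
noncomputable def cyclicShift (M : ℕ) [NeZero M] :
    EuclideanSpace ℝ (ZMod M) →ₗᵢ[ℝ] EuclideanSpace ℝ (ZMod M) :=
  (LinearIsometryEquiv.piLpCongrLeft 2 ℝ ℝ (Equiv.subRight (1 : ZMod M))).toLinearIsometry

lemma cyclicShift_pow_apply (M : ℕ) [NeZero M] (k : ℕ) (f : EuclideanSpace ℝ (ZMod M))
    (i : ZMod M) : (((cyclicShift M).toLinearMap ^ k) f) i = f (i + k) := by
  induction k generalizing i with
  | zero => simp
  | succ k ih =>
    rw [pow_succ', Module.End.mul_apply]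
    have : ∀ h : EuclideanSpace ℝ (ZMod M), ((cyclicShift M).toLinearMap h) i = h (i + 1) := by
      intro h
      simp [cyclicShift, LinearIsometryEquiv.piLpCongrLeft_apply, Equiv.piCongrLeft'_apply]
    rw [this, ih]
    rw [Nat.cast_succ, add_assoc, add_comm (1 : ZMod M)]

/-- A geometric sequence is an eigenvector of the shift except where indices wrap around; `hi`
excludes that. -/
lemma aeval_cyclicShift_geometric (M : ℕ) [NeZero M] (Q : ℝ[X]) (y : ℝ) (i : ℕ)
    (hi : i + Q.natDegree < M) :
    (aeval (cyclicShift M).toLinearMap Q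
      (WithLp.toLp 2 fun j : ZMod M => y ^ j.val : EuclideanSpace ℝ (ZMod M))) (i : ZMod M)
      = Q.eval y * y ^ i := by
  rw [aeval_eq_sum_range, eval_eq_sum_range, LinearMap.sum_apply, Finset.sum_mul]
  rw [WithLp.ofLp_sum, Finset.sum_apply]
  refine Finset.sum_congr rfl fun k hk => ?_
  have hk' := Finset.mem_range.1 hk
  rw [LinearMap.smul_apply, PiLp.smul_apply, cyclicShift_pow_apply]
  have : ((i : ZMod M) + (k : ZMod M)).val = i + k := by
    rw [← Nat.cast_add, ZMod.val_natCast, Nat.mod_eq_of_lt (by omega)]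
  simp only [this, smul_eq_mul]
  ring

lemma norm_aeval_prod_annihilatorPoly_le {H : Type*} [NormedAddCommGroup H]
    [InnerProductSpace ℝ H] (U : H →ₗᵢ[ℝ] H) (S : Finset ℕ) (q : ℕ → ℝ) (m : ℕ → ℕ)
    (hq : ∀ n ∈ S, 1 < q n) (hm : ∀ n ∈ S, 0 < m n)
    (hqm : ∀ n ∈ S, 4 * q n ≤ (m n * (q n - 1)) ^ 2) (f : H) :
    ‖aeval U.toLinearMap (∏ n ∈ S, annihilatorPoly (q n) (m n)) f‖ ≤ ‖f‖ := by
  induction S using Finset.induction_on with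
  | empty => simp
  | insert n S hn ih =>
    rw [Finset.prod_insert hn, map_mul, Module.End.mul_apply]
    simp only [Finset.mem_insert, forall_eq_or_imp] at hq hm hqm
    exact (norm_aeval_annihilatorPoly_le U hq.1 hm.1 hqm.1 _).trans (ih hq.2 hm.2 hqm.2)

lemma card_mul_sq_le_norm_sq (M : ℕ) [NeZero M] (f : EuclideanSpace ℝ (ZMod M)) {k : ℕ}
    (hk : k ≤ M) {v : ℝ} (hv : 0 ≤ v) (h : ∀ i < k, v ≤ f (i : ZMod M)) :
    k * v ^ 2 ≤ ‖f‖ ^ 2 := by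
  have hinj : Set.InjOn (fun i : ℕ => (i : ZMod M)) (Finset.range k) := by
    intro i hi j hj hij
    have hi' := Finset.mem_range.1 (Finset.mem_coe.1 hi)
    have hj' := Finset.mem_range.1 (Finset.mem_coe.1 hj)
    have := congrArg ZMod.val hij
    simpa [ZMod.val_natCast, Nat.mod_eq_of_lt (hi'.trans_le hk),
      Nat.mod_eq_of_lt (hj'.trans_le hk)] using this
  rw [EuclideanSpace.norm_sq_eq]
  calc k * v ^ 2 = ∑ i ∈ Finset.range k, v ^ 2 := by simp
    _ ≤ ∑ i ∈ Finset.range k, ‖f (i : ZMod M)‖ ^ 2 := by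
      refine Finset.sum_le_sum fun i hi => ?_
      rw [Real.norm_eq_abs, sq_abs]
      have := h i (Finset.mem_range.1 hi)
      gcongr
    _ = ∑ j ∈ (Finset.range k).image (fun i : ℕ => (i : ZMod M)), ‖f j‖ ^ 2 := by
      rw [Finset.sum_image hinj]
    _ ≤ _ := Finset.sum_le_sum_of_subset_of_nonneg (Finset.subset_univ _)
      fun _ _ _ => by positivity

/-! ### Lower bound for approximating `x⁻¹` with sparse exponents -/

/-- This is `x ≤ 2 sinh (x / 2)` multiplied by `exp (x / 2)` and squared. -/
lemma sq_mul_exp_le_exp_sub_one_sq {x : ℝ} (hx : 0 ≤ x) :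
    x ^ 2 * Real.exp x ≤ (Real.exp x - 1) ^ 2 := by
  have h1 : x / 2 ≤ Real.sinh (x / 2) := Real.self_le_sinh_iff.2 (by linarith)
  have h2 : Real.exp x - 1 = 2 * Real.sinh (x / 2) * Real.exp (x / 2) := by
    rw [Real.sinh_eq]
    have e1 : Real.exp x = Real.exp (x / 2) * Real.exp (x / 2) := by
      rw [← Real.exp_add]; ring_nf
    have e2 : Real.exp (-(x / 2)) * Real.exp (x / 2) = 1 := by
      rw [← Real.exp_add]; simp
    rw [e1]
    linear_combination e2
  have e1 : Real.exp x = Real.exp (x / 2) ^ 2 := by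
    rw [← Real.exp_nat_mul]; ring_nf
  rw [h2, e1, mul_pow]
  have : x ≤ 2 * Real.sinh (x / 2) := by linarith
  gcongr

/-- A polynomial with sparse exponents stays away from `x⁻¹` on `[a, b]`. -/
lemma div_sq_le_of_abs_inv_sub_eval_le {a b : ℝ} (ha : 0 < a) (hab : a < b) (p : ℝ[X])
    (hp : ∀ n ∈ p.support, 0 < n)
    (hsum : ∑ n ∈ p.support, (n : ℝ)⁻¹ ≤ Real.log (b / a) / 16) {ε : ℝ}
    (h : ∀ x ∈ Set.Icc a b, |x⁻¹ - p.eval x| ≤ ε) : a / b ^ 2 ≤ 2 * ε := by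
  have hb : 0 < b := ha.trans hab
  set S := p.support with hS
  set L := Real.log (b / a) with hL
  have hLpos : 0 < L := Real.log_pos ((one_lt_div ha).2 hab)
  -- The grid is fine enough for the rounding errors in the ceilings below, at most `2` per
  -- exponent, to total at most `M / 4`.
  obtain ⟨M, hM⟩ : ∃ M : ℕ, M = 8 * S.card + 1 := ⟨_, rfl⟩
  have hM0 : 0 < M := by omega
  have : NeZero M := ⟨hM0.ne'⟩
  have hMr : (0 : ℝ) < M := by exact_mod_cast hM0
  set t := L / M with ht
  have htpos : 0 < t := by positivity
  set r := Real.exp t with hr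
  have hr0 : 0 < r := Real.exp_pos _
  have hr1 : 1 < r := by rw [hr]; exact Real.one_lt_exp_iff.2 htpos
  have hrM : r ^ M = b / a := by
    rw [hr, ← Real.exp_nat_mul, ht, mul_div_cancel₀ _ hMr.ne', hL, Real.exp_log (by positivity)]
  -- The least `m` with `m * (n * t) ≥ 2`; this yields the contraction condition for `q = r ^ n =
  -- exp (n * t)`.
  set m : ℕ → ℕ := fun n => ⌈2 / (n * t)⌉₊ with hm
  have hnpos : ∀ n ∈ S, (0 : ℝ) < n := fun n hn => by exact_mod_cast hp n hn
  have hmpos : ∀ n ∈ S, 0 < m n := fun n hn => by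
    have := hnpos n hn
    exact Nat.ceil_pos.2 (by positivity)
  have hq1 : ∀ n ∈ S, 1 < r ^ n := fun n hn => one_lt_pow₀ hr1 (hp n hn).ne'
  have hqm : ∀ n ∈ S, 4 * r ^ n ≤ (m n * (r ^ n - 1)) ^ 2 := by
    intro n hn
    have hn0 := hnpos n hn
    have e : r ^ n = Real.exp (n * t) := by rw [hr, ← Real.exp_nat_mul]
    have h1 := sq_mul_exp_le_exp_sub_one_sq (x := n * t) (by positivity)
    rw [← e] at h1
    have h2 : 2 ≤ m n * (n * t) := by
      rw [← div_le_iff₀ (by positivity)]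
      exact Nat.le_ceil _
    calc 4 * r ^ n = 2 ^ 2 * r ^ n := by ring
      _ ≤ (m n * (n * t)) ^ 2 * r ^ n := by gcongr
      _ = m n ^ 2 * ((n * t) ^ 2 * r ^ n) := by ring
      _ ≤ m n ^ 2 * (r ^ n - 1) ^ 2 := by gcongr
      _ = _ := by ring
  set D := ∑ n ∈ S, 2 * m n with hD
  have hDle : (D : ℝ) ≤ M / 2 := by
    have h1 : ∀ n ∈ S, ((2 * m n : ℕ) : ℝ) ≤ 4 / t * (n : ℝ)⁻¹ + 2 := by
      intro n hn
      have hn0 := hnpos n hn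
      have := (Nat.ceil_lt_add_one (show 0 ≤ 2 / (n * t) by positivity)).le
      have e : 4 / t * (n : ℝ)⁻¹ = 2 * (2 / (n * t)) := by field_simp; norm_num
      rw [e]
      push_cast
      linarith
    have h2 : (D : ℝ) ≤ 4 / t * ∑ n ∈ S, (n : ℝ)⁻¹ + 2 * S.card := by
      rw [hD, Nat.cast_sum, Finset.mul_sum]
      refine (Finset.sum_le_sum h1).trans_eq ?_
      rw [Finset.sum_add_distrib]
      simp [mul_comm]
    have h3 : 4 / t * ∑ n ∈ S, (n : ℝ)⁻¹ ≤ 4 / t * (L / 16) := by gcongr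
    have h4 : 4 / t * (L / 16) = M / 4 := by rw [ht]; field_simp; norm_num
    have h5 : (2 : ℝ) * S.card ≤ M / 4 := by rw [hM]; push_cast; linarith
    linarith
  set Q := ∏ n ∈ S, annihilatorPoly (r ^ n) (m n) with hQ
  have hdeg : Q.natDegree ≤ D := (natDegree_prod_le _ _).trans
    (Finset.sum_le_sum fun n _ => natDegree_annihilatorPoly_le _ _)
  have hQr : (r⁻¹) ^ D ≤ Q.eval r⁻¹ := by
    rw [hQ, eval_prod, hD, ← Finset.prod_pow_eq_pow_sum]
    refine Finset.prod_le_prod (fun n _ => by positivity) fun n hn => ?_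
    exact le_eval_annihilatorPoly (hq1 n hn) (by positivity) (inv_le_one_of_one_le₀ hr1.le)
      (hmpos n hn)
  have hQz : ∀ n ∈ S, Q.eval (r ^ n) = 0 := by
    intro n hn
    rw [hQ, eval_prod]
    exact Finset.prod_eq_zero hn (eval_annihilatorPoly_self _ _)
  have hDM : D ≤ M := by
    have : (D : ℝ) ≤ M := by linarith
    exact_mod_cast this
  let e : ℝ → EuclideanSpace ℝ (ZMod M) := fun y => WithLp.toLp 2 fun j : ZMod M => y ^ j.val
  set f : EuclideanSpace ℝ (ZMod M) :=
    a⁻¹ • e r⁻¹ - ∑ n ∈ S, (p.coeff n * a ^ n) • e (r ^ n) with hf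
  have hfj : ∀ j, f j = (a * r ^ j.val)⁻¹ - p.eval (a * r ^ j.val) := by
    intro j
    rw [hf, eval_eq_sum, Polynomial.sum, PiLp.sub_apply, PiLp.smul_apply, WithLp.ofLp_sum,
      Finset.sum_apply]
    congr 1
    · simp [e, mul_comm]
    · refine Finset.sum_congr rfl fun n _ => ?_
      simp only [PiLp.smul_apply, smul_eq_mul, e]
      ring
  have hfε : ∀ j, |f j| ≤ ε := by
    intro j
    rw [hfj]
    refine h _ ⟨?_, ?_⟩
    · exact le_mul_of_one_le_right ha.le (one_le_pow₀ hr1.le)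
    · calc a * r ^ j.val ≤ a * r ^ M := by
            gcongr
            · exact hr1.le
            · exact (ZMod.val_lt j).le
        _ = b := by rw [hrM]; field_simp
  have hε : 0 ≤ ε := (abs_nonneg _).trans (hfε 0)
  have hfn : ‖f‖ ^ 2 ≤ M * ε ^ 2 := by
    rw [EuclideanSpace.norm_sq_eq]
    calc ∑ j, ‖f j‖ ^ 2 ≤ ∑ _j : ZMod M, ε ^ 2 :=
          Finset.sum_le_sum fun j _ => by
            have := hfε j
            rw [Real.norm_eq_abs]
            gcongr
      _ = _ := by simp [ZMod.card]
  set F := aeval (cyclicShift M).toLinearMap Q f with hF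
  have hFn : ‖F‖ ≤ ‖f‖ :=
    norm_aeval_prod_annihilatorPoly_le (cyclicShift M) S _ m hq1 hmpos hqm f
  -- At these indices, at least half of all, no wrap-around occurs: the terms of `p` vanish and only
  -- `x⁻¹` contributes.
  have hFi : ∀ i < M - D, a / b ^ 2 ≤ F (i : ZMod M) := by
    intro i hi
    have hi' : i + Q.natDegree < M := by omega
    have e1 : F (i : ZMod M) = a⁻¹ * (Q.eval r⁻¹ * r⁻¹ ^ i) := by
      rw [hF, hf, map_sub, map_sum, map_smul, PiLp.sub_apply, PiLp.smul_apply, WithLp.ofLp_sum,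
        Finset.sum_apply]
      rw [Finset.sum_eq_zero, sub_zero, smul_eq_mul]
      · rw [aeval_cyclicShift_geometric M Q _ i hi']
      · intro n hn
        rw [map_smul, PiLp.smul_apply, aeval_cyclicShift_geometric M Q _ i hi', hQz n hn]
        simp
    rw [e1]
    -- One factor `r⁻¹ ^ M` bounds `Q.eval r⁻¹` from below, the other bounds `r⁻¹ ^ i`.
    have e2 : a / b ^ 2 = a⁻¹ * (r⁻¹ ^ M * r⁻¹ ^ M) := by
      rw [inv_pow, hrM]; field_simp
    rw [e2]
    have hri : r⁻¹ ≤ 1 := inv_le_one_of_one_le₀ hr1.le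
    have hri0 : 0 ≤ r⁻¹ := by positivity
    have e3 : r⁻¹ ^ M ≤ Q.eval r⁻¹ := (pow_le_pow_of_le_one hri0 hri hDM).trans hQr
    have e4 : r⁻¹ ^ M ≤ r⁻¹ ^ i := pow_le_pow_of_le_one hri0 hri (by omega)
    have e5 : 0 ≤ r⁻¹ ^ M := by positivity
    gcongr
    exact e5.trans e3
  set v := a / b ^ 2 with hv
  have hv0 : 0 ≤ v := by positivity
  have key := card_mul_sq_le_norm_sq M F (Nat.sub_le M D) hv0 hFi
  rw [Nat.cast_sub hDM] at key
  have k1 : (M : ℝ) / 2 * v ^ 2 ≤ (M - D) * v ^ 2 := by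
    have : (M : ℝ) / 2 ≤ M - D := by linarith
    gcongr
  have k2 : ‖F‖ ^ 2 ≤ ‖f‖ ^ 2 := by gcongr
  have k3 : (M : ℝ) * v ^ 2 ≤ M * (2 * ε ^ 2) := by linarith
  have k4 : v ^ 2 ≤ 2 * ε ^ 2 := le_of_mul_le_mul_left k3 hMr
  refine le_of_sq_le_sq ?_ (by positivity)
  nlinarith [sq_nonneg ε]

/-! ### Approximating `x⁻¹` forces divergence -/

/-- `x⁻¹` is a uniform limit on `[a, b]` of polynomials with exponents in `N`. -/
def InvApproximable (N : Set ℕ) (a b : ℝ) : Prop :=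
  ∀ ε > 0, ∃ p : ℝ[X], (∀ n ∈ p.support, n ∈ N) ∧ ∀ x ∈ Set.Icc a b, |x⁻¹ - p.eval x| ≤ ε

/-- The operator `f ↦ ρ ^ n f(x) - f(ρ x)` kills `x ^ n` and multiplies `x⁻¹` by `ρ ^ n - ρ⁻¹ ≠ 0`.
The dilation by `ρ = b / c` costs the piece `[c, b]`. -/
lemma InvApproximable.diff_singleton {N : Set ℕ} {a b c : ℝ} (h : InvApproximable N a b)
    (ha : 0 < a) (hac : a < c) (hcb : c < b) (n : ℕ) : InvApproximable (N \ {n}) a c := by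
  have hc : 0 < c := ha.trans hac
  set ρ := b / c with hρ
  have hρ1 : 1 < ρ := (one_lt_div hc).2 hcb
  have hρ0 : 0 < ρ := by linarith
  have hκ : 0 < ρ ^ n - ρ⁻¹ := by
    have h1 := one_le_pow₀ (n := n) hρ1.le
    have h2 := inv_lt_one_of_one_lt₀ hρ1
    linarith
  set κ := ρ ^ n - ρ⁻¹ with hκd
  intro ε hε
  obtain ⟨p, hpN, hp⟩ := h (ε * κ / (1 + ρ ^ n)) (by positivity)
  refine ⟨C κ⁻¹ * (C (ρ ^ n) * p - p.comp (C ρ * X)), ?_, ?_⟩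
  · intro k hk
    rw [mem_support_iff, coeff_C_mul, coeff_sub, coeff_C_mul, comp_C_mul_X_coeff] at hk
    refine ⟨hpN k ?_, ?_⟩
    · rw [mem_support_iff]
      rintro h0
      simp [h0] at hk
    · rintro rfl
      apply hk
      ring
  · intro x hx
    have hx0 : 0 < x := ha.trans_le hx.1
    have h1 := hp x ⟨hx.1, hx.2.trans hcb.le⟩
    have h2 := hp (ρ * x) ⟨hx.1.trans (le_mul_of_one_le_left hx0.le hρ1.le), by
      calc ρ * x ≤ ρ * c := by gcongr; exact hx.2
        _ = b := by rw [hρ]; field_simp⟩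
    set δ := ε * κ / (1 + ρ ^ n) with hδ
    have e : x⁻¹ - (C κ⁻¹ * (C (ρ ^ n) * p - p.comp (C ρ * X))).eval x
        = κ⁻¹ * (ρ ^ n * (x⁻¹ - p.eval x) - ((ρ * x)⁻¹ - p.eval (ρ * x))) := by
      have : x⁻¹ = κ⁻¹ * (ρ ^ n * x⁻¹ - (ρ * x)⁻¹) := by
        rw [mul_inv, ← sub_mul, ← hκd]; field_simp
      simp only [eval_mul, eval_C, eval_sub, eval_comp, eval_X]
      linear_combination this
    rw [e, abs_mul, abs_of_pos (inv_pos.2 hκ), inv_mul_le_iff₀ hκ]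
    calc |ρ ^ n * (x⁻¹ - p.eval x) - ((ρ * x)⁻¹ - p.eval (ρ * x))|
        ≤ |ρ ^ n * (x⁻¹ - p.eval x)| + |(ρ * x)⁻¹ - p.eval (ρ * x)| := abs_sub _ _
      _ ≤ ρ ^ n * δ + δ := by
        rw [abs_mul, abs_of_pos (pow_pos hρ0 n)]; gcongr
      _ = κ * ε := by rw [hδ]; field_simp; ring

lemma InvApproximable.diff_finset {N : Set ℕ} {a b c : ℝ} (h : InvApproximable N a b)
    (ha : 0 < a) (hac : a < c) (hcb : c < b) (F : Finset ℕ) :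
    InvApproximable (N \ (F : Set ℕ)) a c := by
  induction F using Finset.induction_on generalizing c with
  | empty =>
    intro ε hε
    obtain ⟨p, hpN, hp⟩ := h ε hε
    exact ⟨p, by simpa using hpN, fun x hx => hp x ⟨hx.1, hx.2.trans hcb.le⟩⟩
  | insert n F hn ih =>
    obtain ⟨d, hcd, hdb⟩ := exists_between hcb
    have := (ih (hac.trans hcd) hdb).diff_singleton ha hac hcd n
    rwa [Set.sdiff_sdiff, Set.union_singleton, ← Finset.coe_insert] at this

/-- If `x⁻¹` is a uniform limit of polynomials with exponents in `N` on an interval `[a, b]` of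
positive numbers, then the reciprocals of the elements of `N` have a divergent sum. -/
theorem InvApproximable.reciprocalSumDiverges {N : Set ℕ} {a b : ℝ}
    (h : InvApproximable N a b) (ha : 0 < a) (hab : a < b) :
    ReciprocalSumDiverges (N \ {0}) := by
  intro hs
  obtain ⟨c, hac, hcb⟩ := exists_between hab
  have hs' : Summable ((N \ {0}).indicator fun n : ℕ => 1 / (n : ℝ)) :=
    summable_subtype_iff_indicator.1 hs
  have hL : 0 < Real.log (c / a) / 16 := by
    have := Real.log_pos ((one_lt_div ha).2 hac)
    positivity
  obtain ⟨F, hF⟩ := summable_iff_vanishing_norm.1 hs' _ hL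
  -- Off `F` the reciprocal sums stay below the threshold; `0` is deleted too because the lower
  -- bound needs positive exponents.
  have h' := h.diff_finset ha hac hcb (insert 0 F)
  have hc : 0 < c := ha.trans hac
  obtain ⟨p, hpN, hp⟩ := h' (a / c ^ 2 / 4) (by positivity)
  have hdisj : Disjoint p.support F := by
    rw [Finset.disjoint_left]
    intro n hn hnF
    exact (hpN n hn).2 (by simp [hnF])
  have hpos : ∀ n ∈ p.support, 0 < n := by
    intro n hn
    refine Nat.pos_of_ne_zero ?_
    rintro rfl
    exact (hpN 0 hn).2 (by simp)
  have h1 := hF _ hdisj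
  have h2 : ∑ n ∈ p.support, (N \ {0}).indicator (fun n : ℕ => 1 / (n : ℝ)) n
      = ∑ n ∈ p.support, (n : ℝ)⁻¹ := by
    refine Finset.sum_congr rfl fun n hn => ?_
    have hmem : n ∈ N \ {0} := ⟨(hpN n hn).1, (hpos n hn).ne'⟩
    rw [Set.indicator_of_mem hmem, one_div]
  rw [h2] at h1
  have h3 := div_sq_le_of_abs_inv_sub_eval_le ha hac p hpos
    ((le_abs_self _).trans h1.le) hp
  have h4 : 0 < a / c ^ 2 := by positivity
  linarith

/-! ### Approximating powers from a divergent sum -/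

/-- If `x P' - n P = κ Q` and `P 1 = 0`, then `|P| ≤ |κ / n| max |Q|` on `[0, 1]`: look at a point
where `|P|` is maximal. -/
lemma abs_eval_le_of_X_mul_derivative {P Q : ℝ[X]} {n κ B : ℝ} (hn : 0 < n)
    (hPQ : X * derivative P - C n * P = C κ * Q) (hP : P.eval 1 = 0)
    (hB : ∀ x ∈ Set.Icc (0 : ℝ) 1, |Q.eval x| ≤ B) {x : ℝ} (hx : x ∈ Set.Icc (0 : ℝ) 1) :
    |P.eval x| ≤ |κ / n| * B := by
  have hB0 : 0 ≤ B := (abs_nonneg _).trans (hB x hx)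
  have hc : ContinuousOn (fun y => P.eval y ^ 2) (Set.Icc (0 : ℝ) 1) := by fun_prop
  obtain ⟨y, hy, hmax⟩ := isCompact_Icc.exists_isMaxOn ⟨x, hx⟩ hc
  have hxy : |P.eval x| ≤ |P.eval y| := sq_le_sq.1 (hmax hx)
  refine hxy.trans ?_
  have hev : y * (derivative P).eval y - n * P.eval y = κ * Q.eval y := by
    simpa using congrArg (eval y) hPQ
  have hdone : y * (derivative P).eval y = 0 → |P.eval y| ≤ |κ / n| * B := by
    intro h0
    have : P.eval y = -(κ / n) * Q.eval y := by
      rw [h0] at hev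
      field_simp
      linarith
    rw [this, abs_mul, abs_neg]
    gcongr
    exact hB y hy
  rcases hy.1.eq_or_lt with h0 | h0
  · exact hdone (by simp [← h0])
  rcases hy.2.eq_or_lt with h1 | h1
  · rw [h1, hP, abs_zero]; positivity
  have hloc : IsLocalMax (fun y => P.eval y ^ 2) y := hmax.isLocalMax (Icc_mem_nhds h0 h1)
  have hd : HasDerivAt (fun y => P.eval y ^ 2) (2 * P.eval y * (derivative P).eval y) y := by
    simpa using (P.hasDerivAt y).fun_pow 2
  have hz := hloc.hasDerivAt_eq_zero hd
  rcases mul_eq_zero.1 hz with h | h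
  · have : P.eval y = 0 := by linarith
    rw [this, abs_zero]; positivity
  · exact hdone (by rw [h, mul_zero])

/-- **von Golitschek's estimate** for the distance of `x ^ m` to the span of the `x ^ k`,
`k ∈ T`, on `[0, 1]`. -/
lemma exists_abs_pow_sub_eval_le_prod (m : ℕ) (T : Finset ℕ) (hT : ∀ k ∈ T, 0 < k)
    (hmT : m ∉ T) : ∃ p : ℝ[X], p.support ⊆ T ∧ ∀ x ∈ Set.Icc (0 : ℝ) 1,
      |x ^ m - p.eval x| ≤ ∏ k ∈ T, |((m : ℝ) - k) / k| := by
  induction T using Finset.induction_on with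
  | empty =>
    refine ⟨0, by simp, fun x hx => ?_⟩
    have := pow_le_one₀ (n := m) hx.1 hx.2
    have := pow_nonneg hx.1 m
    simpa [abs_of_nonneg this]
  | insert n T hnT ih =>
    simp only [Finset.mem_insert, forall_eq_or_imp, not_or] at hT hmT
    obtain ⟨p, hpT, hp⟩ := ih hT.2 hmT.2
    -- The operator `x d/dx - n` acts on `x ^ k` as `k - n`. These weights make the new error `P`
    -- solve `x P' - n P = (m - n) (x ^ m - p)`.
    set w : ℕ → ℝ := fun k => ((n : ℝ) - m) / (k - n) with hw
    set s : ℝ[X] := ∑ k ∈ p.support, monomial k (p.coeff k * w k) with hs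
    have hsc : ∀ k, s.coeff k = p.coeff k * w k := by
      intro k
      rw [hs, finsetSum_coeff]
      simp only [coeff_monomial, Finset.sum_ite_eq', mem_support_iff]
      split_ifs with h
      · rfl
      · push Not at h; simp [h]
    have hpn : p.coeff n = 0 := by
      by_contra h
      exact hnT (hpT (mem_support_iff.2 h))
    -- The operator annihilates `X ^ n`, so its coefficient is free and is chosen to make the error
    -- vanish at `1`.
    refine ⟨C (1 + s.eval 1) * X ^ n - s, ?_, ?_⟩
    · intro k hk
      rw [mem_support_iff, coeff_sub, hsc, coeff_C_mul, coeff_X_pow] at hk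
      rw [Finset.mem_insert]
      by_contra hcon
      push Not at hcon
      apply hk
      have : p.coeff k = 0 := by
        by_contra h
        exact hcon.2 (hpT (mem_support_iff.2 h))
      simp [this, hcon.1]
    · intro x hx
      rw [Finset.prod_insert hnT]
      set P : ℝ[X] := X ^ m - (C (1 + s.eval 1) * X ^ n - s) with hP
      have hPQ : X * derivative P - C (n : ℝ) * P = C ((m : ℝ) - n) * (X ^ m - p) := by
        have hXd : ∀ k, (X * derivative P).coeff k = k * P.coeff k := by
          rintro (_ | k)
          · simp
          · rw [coeff_X_mul, coeff_derivative]; push_cast; ring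
        ext k
        rw [coeff_sub, hXd, coeff_C_mul, coeff_C_mul]
        simp only [hP, coeff_sub, hsc, coeff_C_mul, coeff_X_pow]
        by_cases hkn : k = n
        · subst hkn
          simp [hpn, Ne.symm hmT.1]
        · have hk0 : (k : ℝ) - n ≠ 0 := sub_ne_zero.2 (by exact_mod_cast hkn)
          have hwk : ((k : ℝ) - n) * w k = n - m := by rw [hw]; field_simp
          by_cases hkm : k = m
          · subst hkm
            simp only [hkn, if_true, if_false]
            linear_combination p.coeff k * hwk
          · simp only [hkn, hkm, if_false]
            linear_combination p.coeff k * hwk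
      have h := abs_eval_le_of_X_mul_derivative (B := ∏ k ∈ T, |((m : ℝ) - k) / k|)
        (by exact_mod_cast hT.1) hPQ (by simp [hP])
        (by simpa using hp) hx
      simpa [hP] using h

/-- If the reciprocals of the elements of `S` have a divergent sum, then `x ^ m` is a uniform limit
on `[0, c]` of polynomials with exponents in `S`. -/
lemma ReciprocalSumDiverges.exists_abs_pow_sub_eval_le {S : Set ℕ}
    (hS : ReciprocalSumDiverges S) {m : ℕ} (hm : 0 < m) {c : ℝ} (hc : 0 < c) {ε : ℝ}
    (hε : 0 < ε) : ∃ p : ℝ[X], (∀ n ∈ p.support, n ∈ S) ∧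
      ∀ x ∈ Set.Icc (0 : ℝ) c, |x ^ m - p.eval x| ≤ ε := by
  -- For `k > m` each factor is `1 - m / k ≤ exp (-1 / k)`; dropping finitely many exponents
  -- preserves divergence.
  set S' : Set ℕ := S \ (Finset.range (m + 1) : Set ℕ) with hS'
  set u : ℕ → ℝ := S'.indicator fun n : ℕ => 1 / (n : ℝ) with hu
  have hu0 : ∀ n, 0 ≤ u n := fun n => Set.indicator_nonneg (fun _ _ => by positivity) n
  have hns : ¬ Summable u := by
    intro hsum
    apply hS
    rw [show (fun n : S => 1 / ((n : ℕ) : ℝ)) = (fun n : ℕ => 1 / (n : ℝ)) ∘ ((↑) : S → ℕ) from rfl,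
      summable_subtype_iff_indicator]
    refine hsum.congr_cofinite ?_
    rw [Filter.EventuallyEq, Filter.eventually_cofinite]
    refine (Finset.range (m + 1)).finite_toSet.subset fun n hn => ?_
    by_contra hcon
    apply hn
    by_cases hnS : n ∈ S
    · rw [hu, Set.indicator_of_mem hnS, Set.indicator_of_mem (show n ∈ S' from ⟨hnS, hcon⟩)]
    · rw [hu, Set.indicator_of_notMem hnS, Set.indicator_of_notMem (fun h => hnS h.1)]
  have htend := not_summable_iff_tendsto_nat_atTop_of_nonneg hu0 |>.1 hns
  have hexp : Filter.Tendsto (fun K => c ^ m * Real.exp (-∑ n ∈ Finset.range K, u n))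
      Filter.atTop (nhds 0) := by
    have := (Real.tendsto_exp_neg_atTop_nhds_zero.comp htend).const_mul (c ^ m)
    simpa using this
  obtain ⟨K, hK⟩ := (hexp.eventually (gt_mem_nhds hε)).exists
  classical
  set T : Finset ℕ := (Finset.range K).filter (· ∈ S') with hT
  have hTm : ∀ k ∈ T, m < k := by
    intro k hk
    have := ((Finset.mem_filter.1 hk).2).2
    simp only [Finset.coe_range, Set.mem_Iio] at this
    omega
  obtain ⟨p, hpT, hp⟩ := exists_abs_pow_sub_eval_le_prod m T (fun k hk => hm.trans (hTm k hk))
    (fun h => (hTm m h).false)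
  have hprod : ∏ k ∈ T, |((m : ℝ) - k) / k| ≤ Real.exp (-∑ n ∈ Finset.range K, u n) := by
    have h1 : ∑ n ∈ Finset.range K, u n = ∑ n ∈ T, 1 / (n : ℝ) := by
      rw [hT, Finset.sum_filter]
      exact Finset.sum_congr rfl fun n _ => by rw [hu, Set.indicator_apply]
    rw [h1, ← Finset.sum_neg_distrib, Real.exp_sum]
    refine Finset.prod_le_prod (fun _ _ => abs_nonneg _) fun k hk => ?_
    have hmk : (m : ℝ) < k := by exact_mod_cast hTm k hk
    have hm1 : (1 : ℝ) ≤ m := by exact_mod_cast hm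
    have hk0 : (0 : ℝ) < k := by linarith
    rw [abs_div, abs_of_neg (by linarith), abs_of_pos hk0]
    have h2 := Real.add_one_le_exp (-(1 / (k : ℝ)))
    refine le_trans ?_ h2
    rw [div_le_iff₀ hk0]
    have : (-(1 / (k : ℝ)) + 1) * k = k - 1 := by field_simp; ring
    rw [this]
    linarith
  refine ⟨C (c ^ m) * p.comp (C c⁻¹ * X), ?_, ?_⟩
  · intro n hn
    rw [mem_support_iff, coeff_C_mul, comp_C_mul_X_coeff] at hn
    have : n ∈ p.support := by
      rw [mem_support_iff]
      intro h0
      simp [h0] at hn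
    exact ((Finset.mem_filter.1 (hpT this)).2).1
  · intro x hx
    have h1 := hp (c⁻¹ * x) ⟨by have := hx.1; positivity, by
      rw [inv_mul_le_iff₀ hc, mul_one]; exact hx.2⟩
    have e : x ^ m - (C (c ^ m) * p.comp (C c⁻¹ * X)).eval x
        = c ^ m * ((c⁻¹ * x) ^ m - p.eval (c⁻¹ * x)) := by
      simp only [eval_mul, eval_C, eval_comp, eval_X, mul_sub, ← mul_pow]
      rw [mul_inv_cancel_left₀ hc.ne']
    rw [e, abs_mul, abs_of_pos (pow_pos hc m)]
    calc c ^ m * |(c⁻¹ * x) ^ m - p.eval (c⁻¹ * x)|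
        ≤ c ^ m * Real.exp (-∑ n ∈ Finset.range K, u n) := by
          gcongr
          exact h1.trans hprod
      _ ≤ ε := hK.le

/-! ### Duality and reduction from dilates to monomials -/

lemma Submodule.dense_iff_forall_strongDual {E : Type*} [NormedAddCommGroup E] [NormedSpace ℝ E]
    (V : Submodule ℝ E) :
    Dense (V : Set E) ↔ ∀ φ : StrongDual ℝ E, (∀ v ∈ V, φ v = 0) → φ = 0 := by
  constructor
  · intro h φ hφ
    ext x
    have : Set.EqOn φ 0 (V : Set E) := fun v hv => by simpa using hφ v hv
    have := Continuous.ext_on h φ.continuous continuous_zero this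
    simpa using congrFun this x
  · intro h
    by_contra hd
    obtain ⟨x, hx⟩ : ∃ x, x ∉ V.topologicalClosure := by
      by_contra hcon
      push Not at hcon
      exact hd fun x => hcon x
    obtain ⟨f, u, hf, hu⟩ := geometric_hahn_banach_closed_point
      V.topologicalClosure.convex V.isClosed_topologicalClosure hx
    have h0 : ∀ v ∈ V, f v = 0 := by
      intro v hv
      by_contra hne
      -- A functional bounded above on a subspace vanishes there: otherwise a multiple of `v`
      -- attains the bound `u`.
      have := hf ((u / f v) • v) (V.topologicalClosure.smul_mem _ (V.le_topologicalClosure hv))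
      rw [map_smul, smul_eq_mul, div_mul_cancel₀ _ hne] at this
      exact this.false
    have h1 := hf 0 V.topologicalClosure.zero_mem
    rw [h f h0] at h1 hu
    simp only [zero_apply] at h1 hu
    linarith

lemma Submodule.dense_span_iff_forall_strongDual {E : Type*} [NormedAddCommGroup E]
    [NormedSpace ℝ E] (s : Set E) :
    Dense (Submodule.span ℝ s : Set E) ↔
      ∀ φ : StrongDual ℝ E, (∀ v ∈ s, φ v = 0) → φ = 0 := by
  rw [Submodule.dense_iff_forall_strongDual]
  refine forall_congr' fun φ => imp_congr_left ?_
  exact Submodule.span_le (p := LinearMap.ker φ.toLinearMap)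

/-- The function `x ↦ x ^ n` on `[a, b]`. -/
def monomialOn (a b : ℝ) (n : ℕ) : C(Set.Icc a b, ℝ) where
  toFun x := (x : ℝ) ^ n
  continuous_toFun := by fun_prop

/-- The span in `C[a, b]` of the functions `x ↦ x ^ n`, `n ∈ N`. -/
def monomialSpan (N : Set ℕ) (a b : ℝ) : Submodule ℝ C(Set.Icc a b, ℝ) :=
  Submodule.span ℝ (monomialOn a b '' N)

lemma norm_monomialOn_le (a b : ℝ) (n : ℕ) : ‖monomialOn a b n‖ ≤ (max |a| |b|) ^ n := by
  rw [ContinuousMap.norm_le _ (by positivity)]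
  intro x
  change ‖(x : ℝ) ^ n‖ ≤ _
  rw [norm_pow, Real.norm_eq_abs]
  gcongr
  exact abs_le_max_abs_abs x.2.1 x.2.2

/-- An everywhere convergent power series is a power series expansion on the whole line. -/
lemma hasFPowerSeriesOnBall_of_hasSum {c : ℕ → ℝ} {F : ℝ → ℝ}
    (h : ∀ t, HasSum (fun n => c n * t ^ n) (F t)) :
    HasFPowerSeriesOnBall F (FormalMultilinearSeries.ofScalars ℝ c) 0 ⊤ where
  r_le := by
    rw [FormalMultilinearSeries.radius_eq_top_of_summable_norm]
    intro r
    have := (h r).summable.norm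
    refine Summable.of_nonneg_of_le (fun n => by positivity) (fun n => ?_) this
    rw [FormalMultilinearSeries.ofScalars_norm]
    simp
  r_pos := by simp
  hasSum := by
    intro y _
    simpa [FormalMultilinearSeries.ofScalars_apply_eq, mul_comm] using h y

/-- Real parts of the complex Taylor coefficients already sum to `g` on the line; uniqueness of
power series identifies them with the real derivatives. -/
lemma HasEntireExtension.hasSum {g : C(ℝ, ℝ)} (hg : HasEntireExtension g) (x : ℝ) :
    HasSum (fun n => iteratedDeriv n g 0 / n.factorial * x ^ n) (g x) := by
  obtain ⟨G, hG, hGg⟩ := hg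
  set c : ℕ → ℝ := fun n => ((n.factorial : ℂ)⁻¹ * iteratedDeriv n G 0).re with hc
  have h : ∀ t : ℝ, HasSum (fun n => c n * t ^ n) (g t) := by
    intro t
    have h1 := Complex.reCLM.hasSum (Complex.hasSum_taylorSeries_of_entire hG 0 t)
    rw [hGg] at h1
    convert h1 using 1
    · ext n
      simp only [Complex.reCLM_apply, sub_zero, smul_eq_mul, hc]
      rw [← Complex.re_mul_ofReal]
      congr 1
      push_cast
      ring
    · simp
  have hp := (hasFPowerSeriesOnBall_of_hasSum h).hasFPowerSeriesAt
  have heq := hp.eq_formalMultilinearSeries hp.analyticAt.hasFPowerSeriesAt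
  have hce : c = fun n => iteratedDeriv n g 0 / n.factorial :=
    FormalMultilinearSeries.ofScalars_series_injective ℝ ℝ heq
  have := h x
  rwa [hce] at this

lemma HasEntireExtension.hasSum_dual_dilate {g : C(ℝ, ℝ)} (hg : HasEntireExtension g) {a b : ℝ}
    (φ : StrongDual ℝ C(Set.Icc a b, ℝ)) (t : ℝ) :
    HasSum (fun n => iteratedDeriv n g 0 / n.factorial * φ (monomialOn a b n) * t ^ n)
      (φ (dilate g a b t)) := by
  have hsum : Summable fun n : ℕ =>
      (iteratedDeriv n g 0 / n.factorial * t ^ n) • monomialOn a b n := by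
    refine Summable.of_norm_bounded (hg.hasSum (t * max |a| |b|)).summable.norm fun n => ?_
    rw [norm_smul, mul_pow, ← mul_assoc, norm_mul _ (max |a| |b| ^ n),
      norm_pow (max |a| |b|), Real.norm_of_nonneg (show 0 ≤ max |a| |b| by positivity)]
    gcongr
    exact norm_monomialOn_le a b n
  have hval : ∑' n : ℕ, (iteratedDeriv n g 0 / n.factorial * t ^ n) • monomialOn a b n
      = dilate g a b t := by
    ext x
    have h1 := (ContinuousMap.evalCLM ℝ x).hasSum hsum.hasSum
    have h2 := hg.hasSum (t * x)
    refine h1.unique ?_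
    convert h2 using 1
    · ext n
      simp [monomialOn, mul_pow, mul_assoc]
    · rfl
  have h := φ.hasSum hsum.hasSum
  rw [hval] at h
  have e : (fun n => iteratedDeriv n g 0 / n.factorial * φ (monomialOn a b n) * t ^ n)
      = fun n => φ ((iteratedDeriv n g 0 / n.factorial * t ^ n) • monomialOn a b n) := by
    funext n
    rw [map_smul, smul_eq_mul]
    ring
  rw [e]
  exact h

lemma HasEntireExtension.dense_dilateSpan_iff {g : C(ℝ, ℝ)} (hg : HasEntireExtension g)
    {Λ : Set ℝ} (hΛ : ∃ t : ℝ, AccPt t (Filter.principal Λ)) (a b : ℝ) :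
    Dense (dilateSpan g Λ a b : Set C(Set.Icc a b, ℝ)) ↔
      Dense (monomialSpan (derivSupport g) a b : Set C(Set.Icc a b, ℝ)) := by
  rw [dilateSpan, monomialSpan, Submodule.dense_span_iff_forall_strongDual,
    Submodule.dense_span_iff_forall_strongDual]
  refine forall_congr' fun φ => imp_congr_left ?_
  have hF := fun t => hg.hasSum_dual_dilate φ t
  constructor
  · rintro h _ ⟨n, hn, rfl⟩
    have hp := hasFPowerSeriesOnBall_of_hasSum hF
    have han : AnalyticOnNhd ℝ (fun t => φ (dilate g a b t)) Set.univ := by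
      simpa using hp.analyticOnNhd
    obtain ⟨t, ht⟩ := hΛ
    have hfreq : ∃ᶠ z in nhdsWithin t {t}ᶜ, φ (dilate g a b z) = (0 : ℝ → ℝ) z := by
      rw [accPt_iff_frequently] at ht
      rw [frequently_nhdsWithin_iff]
      exact ht.mono fun z hz => ⟨h _ ⟨z, hz.2, rfl⟩, hz.1⟩
    have hzero := han.eq_of_frequently_eq analyticOnNhd_const hfreq
    have hp' := hp.hasFPowerSeriesAt
    rw [hzero] at hp'
    have hs := hp'.eq_zero
    have hc := congrFun ((FormalMultilinearSeries.ofScalars_series_eq_zero ℝ).1 hs) n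
    have hne : iteratedDeriv n g 0 / n.factorial ≠ 0 :=
      div_ne_zero hn (by exact_mod_cast n.factorial_ne_zero)
    exact (mul_eq_zero.1 hc).resolve_left hne
  · rintro h _ ⟨t, _, rfl⟩
    refine (hF t).unique ?_
    convert hasSum_zero with n
    by_cases hn : n ∈ derivSupport g
    · simp [h _ ⟨n, hn, rfl⟩]
    · have : iteratedDeriv n g 0 = 0 := not_not.1 hn
      simp [this]

/-! ### Closures of monomial spans and sufficiency -/

lemma mem_monomialSpan_iff {N : Set ℕ} {a b : ℝ} {f : C(Set.Icc a b, ℝ)} :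
    f ∈ monomialSpan N a b ↔
      ∃ p : ℝ[X], (∀ n ∈ p.support, n ∈ N) ∧ ∀ x : Set.Icc a b, f x = p.eval (x : ℝ) := by
  constructor
  · intro hf
    induction hf using Submodule.span_induction with
    | mem f hf =>
      obtain ⟨n, hn, rfl⟩ := hf
      refine ⟨X ^ n, fun k hk => ?_, fun x => by simp [monomialOn]⟩
      have : k = n := by simpa [coeff_X_pow] using hk
      exact this ▸ hn
    | zero => exact ⟨0, by simp, by simp⟩
    | add f g _ _ hf hg =>
      obtain ⟨p, hpN, hp⟩ := hf
      obtain ⟨q, hqN, hq⟩ := hg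
      refine ⟨p + q, fun n hn => ?_, fun x => by simp [hp, hq]⟩
      rcases Finset.mem_union.1 (support_add hn) with h | h
      exacts [hpN n h, hqN n h]
    | smul c f _ hf =>
      obtain ⟨p, hpN, hp⟩ := hf
      exact ⟨c • p, fun n hn => hpN n (support_smul c p hn), fun x => by simp [hp]⟩
  · rintro ⟨p, hpN, hp⟩
    have : f = ∑ n ∈ p.support, p.coeff n • monomialOn a b n := by
      ext x
      rw [hp, eval_eq_sum, Polynomial.sum]
      simp [monomialOn, ContinuousMap.coe_sum]
    rw [this]
    exact Submodule.sum_mem _ fun n hn =>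
      Submodule.smul_mem _ _ (Submodule.subset_span ⟨n, hpN n hn, rfl⟩)

lemma mem_topologicalClosure_monomialSpan_iff {N : Set ℕ} {a b : ℝ} {f : C(Set.Icc a b, ℝ)} :
    f ∈ (monomialSpan N a b).topologicalClosure ↔
      ∀ ε > 0, ∃ p : ℝ[X], (∀ n ∈ p.support, n ∈ N) ∧
        ∀ x : Set.Icc a b, |f x - p.eval (x : ℝ)| ≤ ε := by
  rw [← SetLike.mem_coe, Submodule.topologicalClosure_coe, Metric.mem_closure_iff]
  constructor
  · intro h ε hε
    obtain ⟨g, hg, hfg⟩ := h ε hε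
    obtain ⟨p, hpN, hp⟩ := mem_monomialSpan_iff.1 hg
    refine ⟨p, hpN, fun x => ?_⟩
    rw [← hp, ← Real.dist_eq]
    exact (ContinuousMap.dist_apply_le_dist x).trans hfg.le
  · intro h ε hε
    obtain ⟨p, hpN, hp⟩ := h (ε / 2) (by positivity)
    refine ⟨p.toContinuousMapOn _, mem_monomialSpan_iff.2 ⟨p, hpN, fun x => by simp⟩, ?_⟩
    refine lt_of_le_of_lt ?_ (half_lt_self hε)
    rw [ContinuousMap.dist_le (by positivity)]
    intro x
    rw [Real.dist_eq]
    simpa using hp x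

lemma dense_monomialSpan_iff {N : Set ℕ} {a b : ℝ} :
    Dense (monomialSpan N a b : Set C(Set.Icc a b, ℝ)) ↔
      ∀ f, f ∈ (monomialSpan N a b).topologicalClosure :=
  Iff.rfl

lemma monomialSpan_le_topologicalClosure {N K : Set ℕ} {a b : ℝ}
    (h : ∀ m ∈ K, monomialOn a b m ∈ (monomialSpan N a b).topologicalClosure) :
    (monomialSpan K a b).topologicalClosure ≤ (monomialSpan N a b).topologicalClosure := by
  refine Submodule.topologicalClosure_minimal _ ?_ (Submodule.isClosed_topologicalClosure _)
  refine Submodule.span_le.2 ?_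
  rintro _ ⟨m, hm, rfl⟩
  exact h m hm

lemma dense_monomialSpan_of_forall_mem {N : Set ℕ} {a b : ℝ}
    (h : ∀ m, monomialOn a b m ∈ (monomialSpan N a b).topologicalClosure) :
    Dense (monomialSpan N a b : Set C(Set.Icc a b, ℝ)) := by
  rw [dense_monomialSpan_iff]
  intro f
  refine monomialSpan_le_topologicalClosure (K := Set.univ) (fun m _ => h m) ?_
  rw [mem_topologicalClosure_monomialSpan_iff]
  intro ε hε
  obtain ⟨p, hp⟩ := exists_polynomial_near_continuousMap a b f ε hε
  refine ⟨p, fun _ _ => trivial, fun x => ?_⟩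
  have h1 := ContinuousMap.norm_coe_le_norm (p.toContinuousMapOn (Set.Icc a b) - f) x
  rw [abs_sub_comm]
  exact (by simpa using h1 : |p.eval (x : ℝ) - f x| ≤ _).trans hp.le

/-- Away from `0` the constants are uniform limits of polynomials without constant term. -/
lemma dense_monomialSpan_of_forall_pos_mem {N : Set ℕ} {a b : ℝ} (h0 : (0 : ℝ) ∉ Set.Icc a b)
    (h : ∀ m, 0 < m → monomialOn a b m ∈ (monomialSpan N a b).topologicalClosure) :
    Dense (monomialSpan N a b : Set C(Set.Icc a b, ℝ)) := by
  refine dense_monomialSpan_of_forall_mem fun m => ?_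
  rcases Nat.eq_zero_or_pos m with rfl | hm
  swap
  · exact h m hm
  refine monomialSpan_le_topologicalClosure (K := {n | 0 < n}) h ?_
  rw [mem_topologicalClosure_monomialSpan_iff]
  intro ε hε
  set R := max |a| |b| + 1 with hR
  have hRpos : 0 < R := by positivity
  have hne : ∀ x ∈ Set.Icc a b, x ≠ 0 := fun x hx h => h0 (h ▸ hx)
  obtain ⟨p, hp⟩ := exists_polynomial_near_of_continuousOn a b (fun x => x⁻¹)
    (continuousOn_id.inv₀ hne) (ε / R) (by positivity)
  -- Since `1 = x * x⁻¹`, an approximation `p` of `x⁻¹` gives one of `1` by `X * p`.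
  refine ⟨X * p, fun n hn => ?_, fun x => ?_⟩
  · refine Nat.pos_of_ne_zero ?_
    rintro rfl
    simp at hn
  · have hx0 := hne x x.2
    have e : monomialOn a b 0 x - (X * p).eval (x : ℝ) = x * -(p.eval (x : ℝ) - (x : ℝ)⁻¹) := by
      simp only [monomialOn, ContinuousMap.coe_mk, pow_zero, eval_mul, eval_X]
      field_simp
      ring
    have hxR : |(x : ℝ)| ≤ R := (abs_le_max_abs_abs x.2.1 x.2.2).trans (by linarith)
    rw [e, abs_mul, abs_neg]
    calc |(x : ℝ)| * |p.eval (x : ℝ) - (x : ℝ)⁻¹| ≤ R * (ε / R) := by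
          gcongr
          exact (hp x x.2).le
      _ = ε := by field_simp

/-- Substituting `|x|` carries the approximation from `[0, c]` to `[a, b]`. The exponent sign `σ` is
absorbed into the coefficients and the common sign `w` factors out of the error, which handles
half-lines and both parities at once. -/
lemma monomialOn_mem_of_reciprocalSumDiverges {N S : Set ℕ} (hSN : S ⊆ N)
    (hS : ReciprocalSumDiverges S) {m : ℕ} (hm : 0 < m) {a b : ℝ} (σ : ℕ → ℝ) (w : ℝ → ℝ)
    (hσ : ∀ k, σ k * σ k = 1) (hw : ∀ x, |w x| = 1)
    (h : ∀ k, k ∈ S ∨ k = m → ∀ x ∈ Set.Icc a b, x ^ k = σ k * w x * |x| ^ k) :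
    monomialOn a b m ∈ (monomialSpan N a b).topologicalClosure := by
  rw [mem_topologicalClosure_monomialSpan_iff]
  intro ε hε
  obtain ⟨p, hpS, hp⟩ := hS.exists_abs_pow_sub_eval_le hm
    (show 0 < max |a| |b| + 1 by positivity) hε
  refine ⟨∑ k ∈ p.support, monomial k (σ m * σ k * p.coeff k), fun n hn => ?_, fun x => ?_⟩
  · refine hSN (hpS n ?_)
    by_contra hcon
    rw [mem_support_iff, finsetSum_coeff] at hn
    simp only [coeff_monomial, Finset.sum_ite_eq', hcon, if_false] at hn
    exact hn rfl
  · have h1 := hp |(x : ℝ)| ⟨abs_nonneg _,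
      (abs_le_max_abs_abs x.2.1 x.2.2).trans (by linarith)⟩
    have e : monomialOn a b m x
        - (∑ k ∈ p.support, monomial k (σ m * σ k * p.coeff k)).eval (x : ℝ)
        = σ m * w x * (|(x : ℝ)| ^ m - p.eval |(x : ℝ)|) := by
      rw [eval_finsetSum, mul_sub, eval_eq_sum, Polynomial.sum, Finset.mul_sum]
      congr 1
      · exact h m (Or.inr rfl) x x.2
      · refine Finset.sum_congr rfl fun k hk => ?_
        rw [eval_monomial, h k (Or.inl (hpS k hk)) x x.2]
        linear_combination (σ m * p.coeff k * w x * |(x : ℝ)| ^ k) * hσ k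
    have hσm : |σ m| = 1 := by
      have := hσ m
      rcases mul_self_eq_one_iff.1 this with h | h <;> simp [h]
    rw [e, abs_mul, abs_mul, hσm, hw, one_mul, one_mul]
    exact h1

lemma monomialOn_mem_of_sign {N : Set ℕ} (hN : ReciprocalSumDiverges (N \ {0})) {a b : ℝ}
    (hab : 0 ≤ a ∨ b ≤ 0) {m : ℕ} (hm : 0 < m) :
    monomialOn a b m ∈ (monomialSpan N a b).topologicalClosure := by
  rcases hab with ha | hb
  · refine monomialOn_mem_of_reciprocalSumDiverges Set.sdiff_subset hN hm (fun _ => 1)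
      (fun _ => 1) (by simp) (by simp) fun k _ x hx => ?_
    rw [abs_of_nonneg (ha.trans hx.1)]; simp
  · refine monomialOn_mem_of_reciprocalSumDiverges Set.sdiff_subset hN hm (fun k => (-1) ^ k)
      (fun _ => 1) (fun k => ?_) (by simp) fun k _ x hx => ?_
    · rw [← mul_pow]; simp
    · rw [abs_of_nonpos (hx.2.trans hb), mul_one, ← mul_pow]; simp

lemma monomialOn_mem_of_even {N : Set ℕ}
    (hN : ReciprocalSumDiverges {n | n ∈ N \ {0} ∧ Even n}) (a b : ℝ) {m : ℕ} (hm : 0 < m)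
    (hme : Even m) : monomialOn a b m ∈ (monomialSpan N a b).topologicalClosure := by
  refine monomialOn_mem_of_reciprocalSumDiverges (fun n hn => hn.1.1) hN hm (fun _ => 1)
    (fun _ => 1) (by simp) (by simp) fun k hk x _ => ?_
  have hke : Even k := by
    rcases hk with hk | rfl
    exacts [hk.2, hme]
  rw [hke.pow_abs]; simp

lemma monomialOn_mem_of_odd {N : Set ℕ}
    (hN : ReciprocalSumDiverges {n | n ∈ N ∧ Odd n}) (a b : ℝ) {m : ℕ}
    (hmo : Odd m) : monomialOn a b m ∈ (monomialSpan N a b).topologicalClosure := by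
  refine monomialOn_mem_of_reciprocalSumDiverges (fun n hn => hn.1) hN hmo.pos (fun _ => 1)
    (fun x => if 0 ≤ x then 1 else -1) (by simp) (fun x => by split_ifs <;> simp)
    fun k hk x _ => ?_
  have hko : Odd k := by
    rcases hk with hk | rfl
    exacts [hk.2, hmo]
  split_ifs with h
  · rw [abs_of_nonneg h]; simp
  · rw [abs_of_neg (not_le.1 h), hko.neg_pow]; simp

/-! ### Necessary conditions from density -/

lemma zero_mem_of_dense_monomialSpan {N : Set ℕ} {a b : ℝ} (h0 : (0 : ℝ) ∈ Set.Icc a b)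
    (h : Dense (monomialSpan N a b : Set C(Set.Icc a b, ℝ))) : 0 ∈ N := by
  obtain ⟨p, hpN, hp⟩ := mem_topologicalClosure_monomialSpan_iff.1
    (dense_monomialSpan_iff.1 h 1) (1 / 2) (by norm_num)
  by_contra hN
  have hp0 : p.eval 0 = 0 := by
    rw [← coeff_zero_eq_eval_zero]
    by_contra hne
    exact hN (hpN 0 (mem_support_iff.2 hne))
  have := hp ⟨0, h0⟩
  rw [hp0] at this
  norm_num at this

lemma exists_poly_of_dense_monomialSpan {N : Set ℕ} {a b : ℝ}
    (h : Dense (monomialSpan N a b : Set C(Set.Icc a b, ℝ))) {f : ℝ → ℝ} (hf : Continuous f)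
    {ε : ℝ} (hε : 0 < ε) : ∃ p : ℝ[X], (∀ n ∈ p.support, n ∈ N) ∧
      ∀ x ∈ Set.Icc a b, |f x - p.eval x| ≤ ε := by
  obtain ⟨p, hpN, hp⟩ := mem_topologicalClosure_monomialSpan_iff.1
    (dense_monomialSpan_iff.1 h ⟨fun x => f x, by fun_prop⟩) ε hε
  exact ⟨p, hpN, fun x hx => hp ⟨x, hx⟩⟩

/-- An even continuous function on the whole line that equals `x⁻¹` for `x ≥ δ`. -/
lemma continuous_inv_max_abs {δ : ℝ} (hδ : 0 < δ) :
    Continuous fun x : ℝ => (max |x| δ)⁻¹ :=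
  Continuous.inv₀ (by fun_prop) fun _ => (lt_max_of_lt_right hδ).ne'

lemma InvApproximable.of_dense_monomialSpan {N : Set ℕ} {a b c d σ : ℝ}
    (h : Dense (monomialSpan N a b : Set C(Set.Icc a b, ℝ))) (hc : 0 < c) (hσ : |σ| = 1)
    (hcd : ∀ x ∈ Set.Icc c d, σ * x ∈ Set.Icc a b) : InvApproximable N c d := by
  intro ε hε
  obtain ⟨p, hpN, hp⟩ := exists_poly_of_dense_monomialSpan h (continuous_inv_max_abs hc) hε
  refine ⟨p.comp (C σ * X), fun n hn => hpN n ?_, fun x hx => ?_⟩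
  · rw [mem_support_iff, comp_C_mul_X_coeff] at hn
    exact mem_support_iff.2 (left_ne_zero_of_mul hn)
  · have h1 := hp (σ * x) (hcd x hx)
    rw [abs_mul, hσ, one_mul, abs_of_pos (hc.trans_le hx.1), max_eq_left hx.1] at h1
    simpa using h1

/-- Passing to the even or odd part: the sign `s` is `1` for the even part and `-1` for the odd
part. -/
lemma InvApproximable.of_dense_monomialSpan_symm {N : Set ℕ} {a b c d s : ℝ}
    (h : Dense (monomialSpan N a b : Set C(Set.Icc a b, ℝ)))
    {f : ℝ → ℝ} (hf : Continuous f) (hs : |s| = 1) (hfc : ∀ x, c ≤ x → f x = x⁻¹)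
    (hfs : ∀ x, f (-x) = s * f x)
    (hcd : ∀ x ∈ Set.Icc c d, x ∈ Set.Icc a b ∧ -x ∈ Set.Icc a b) :
    InvApproximable {n | n ∈ N ∧ (-1) ^ n ≠ -s} c d := by
  intro ε hε
  have hss : s * s = 1 := by rw [← abs_mul_abs_self, hs, one_mul]
  obtain ⟨p, hpN, hp⟩ := exists_poly_of_dense_monomialSpan h hf hε
  refine ⟨C (1 / 2 : ℝ) * (p + C s * p.comp (C (-1) * X)), fun n hn => ?_, fun x hx => ?_⟩
  · rw [mem_support_iff, coeff_C_mul, coeff_add, coeff_C_mul, comp_C_mul_X_coeff] at hn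
    refine ⟨hpN n (mem_support_iff.2 fun h0 => hn (by simp [h0])), fun hns => hn ?_⟩
    rw [hns]
    linear_combination (-(1 / 2) * p.coeff n) * hss
  · have h1 := hp x (hcd x hx).1
    have h2 := hp (-x) (hcd x hx).2
    rw [hfs] at h2
    rw [hfc x hx.1] at h1 h2
    have e : x⁻¹ - (C (1 / 2 : ℝ) * (p + C s * p.comp (C (-1) * X))).eval x
        = 1 / 2 * ((x⁻¹ - p.eval x) + s * (s * x⁻¹ - p.eval (-x))) := by
      simp only [eval_mul, eval_C, eval_add, eval_comp, eval_X, neg_one_mul]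
      linear_combination (-(1 / 2) * x⁻¹) * hss
    rw [e, abs_mul, abs_of_pos (by norm_num : (0 : ℝ) < 1 / 2)]
    have h3 := abs_add_le (x⁻¹ - p.eval x) (s * (s * x⁻¹ - p.eval (-x)))
    rw [abs_mul, hs, one_mul] at h3
    linarith

/-! ### Müntz's theorem in the three positions of `0` -/

/-- **Müntz's theorem** on an interval that does not contain `0` (with natural exponents). -/
theorem dense_monomialSpan_iff_of_zero_notMem {N : Set ℕ} {a b : ℝ} (hab : a < b)
    (h0 : 0 < a ∨ b < 0) :
    Dense (monomialSpan N a b : Set C(Set.Icc a b, ℝ)) ↔ ReciprocalSumDiverges (N \ {0}) := by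
  constructor
  · intro h
    rcases h0 with ha | hb
    · exact (InvApproximable.of_dense_monomialSpan h ha (σ := 1) (by simp)
        (fun x hx => by simpa using hx)).reciprocalSumDiverges ha hab
    · exact (InvApproximable.of_dense_monomialSpan h (neg_pos.2 hb) (σ := -1) (d := -a) (by simp)
        (fun x hx => ⟨by linarith [hx.2], by linarith [hx.1]⟩)).reciprocalSumDiverges
        (neg_pos.2 hb) (by linarith)
  · intro h
    refine dense_monomialSpan_of_forall_pos_mem (fun hx => ?_) fun m hm =>
      monomialOn_mem_of_sign h (h0.imp le_of_lt le_of_lt) hm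
    rcases h0 with ha | hb
    · exact absurd hx.1 (not_le.2 ha)
    · exact absurd hx.2 (not_le.2 hb)

/-- **Müntz's theorem** on an interval with endpoint `0` (with natural exponents). -/
theorem dense_monomialSpan_iff_of_endpoint_zero {N : Set ℕ} {a b : ℝ} (hab : a < b)
    (h0 : a = 0 ∨ b = 0) :
    Dense (monomialSpan N a b : Set C(Set.Icc a b, ℝ)) ↔
      0 ∈ N ∧ ReciprocalSumDiverges (N \ {0}) := by
  constructor
  · intro h
    rcases h0 with rfl | rfl
    · refine ⟨zero_mem_of_dense_monomialSpan ⟨le_rfl, hab.le⟩ h, ?_⟩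
      exact (InvApproximable.of_dense_monomialSpan h (half_pos hab) (σ := 1) (d := b) (by simp)
        (fun x hx => ⟨by linarith [hx.1], by linarith [hx.2]⟩)).reciprocalSumDiverges
        (half_pos hab) (half_lt_self hab)
    · refine ⟨zero_mem_of_dense_monomialSpan ⟨hab.le, le_rfl⟩ h, ?_⟩
      have ha : 0 < -a := neg_pos.2 hab
      exact (InvApproximable.of_dense_monomialSpan h (half_pos ha) (σ := -1) (d := -a) (by simp)
        (fun x hx => ⟨by linarith [hx.2], by linarith [hx.1]⟩)).reciprocalSumDiverges
        (half_pos ha) (half_lt_self ha)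
  · rintro ⟨hN0, h⟩
    refine dense_monomialSpan_of_forall_mem fun m => ?_
    rcases Nat.eq_zero_or_pos m with rfl | hm
    · exact Submodule.le_topologicalClosure _ (Submodule.subset_span ⟨0, hN0, rfl⟩)
    · exact monomialOn_mem_of_sign h (h0.imp ge_of_eq le_of_eq) hm

/-- **Müntz's theorem** on an interval with `0` in its interior (with natural exponents). -/
theorem dense_monomialSpan_iff_of_zero_mem_Ioo {N : Set ℕ} {a b : ℝ} (ha : a < 0) (hb : 0 < b) :
    Dense (monomialSpan N a b : Set C(Set.Icc a b, ℝ)) ↔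
      0 ∈ N ∧ ReciprocalSumDiverges {n | n ∈ N \ {0} ∧ Even n} ∧
        ReciprocalSumDiverges {n | n ∈ N ∧ Odd n} := by
  constructor
  · intro h
    obtain ⟨d, hd, hda, hdb⟩ : ∃ d, 0 < d ∧ d ≤ -a ∧ d ≤ b :=
      ⟨min (-a) b, lt_min (neg_pos.2 ha) hb, min_le_left _ _, min_le_right _ _⟩
    have hc : 0 < d / 2 := half_pos hd
    have hcd : ∀ x ∈ Set.Icc (d / 2) d, x ∈ Set.Icc a b ∧ -x ∈ Set.Icc a b := fun x hx =>
      ⟨⟨by linarith [hx.1], by linarith [hx.2]⟩, ⟨by linarith [hx.2], by linarith [hx.1]⟩⟩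
    have hcont := continuous_inv_max_abs hc
    refine ⟨zero_mem_of_dense_monomialSpan ⟨ha.le, hb.le⟩ h, ?_, ?_⟩
    · have h1 := (InvApproximable.of_dense_monomialSpan_symm (s := 1) h hcont (by simp)
        (fun x hx => by rw [abs_of_pos (hc.trans_le hx), max_eq_left hx])
        (fun x => by simp) hcd).reciprocalSumDiverges hc (half_lt_self hd)
      convert h1 using 1
      ext n
      rcases Nat.even_or_odd n with hn | hn
      · simp only [Set.mem_sdiff, Set.mem_singleton_iff, Set.mem_ofPred_eq, hn, hn.neg_one_pow]
        norm_num
      · simp [hn, hn.neg_one_pow]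
    · have h1 := (InvApproximable.of_dense_monomialSpan_symm (s := -1) h
        -- An odd continuous function equal to `x⁻¹` for `x ≥ d / 2`.
        (f := fun x => x * ((max |x| (d / 2))⁻¹ * (max |x| (d / 2))⁻¹))
        (continuous_id.mul (hcont.mul hcont)) (by simp)
        (fun x hx => by
          have hx0 := hc.trans_le hx
          rw [abs_of_pos hx0, max_eq_left hx]
          field_simp)
        (fun x => by simp) hcd).reciprocalSumDiverges hc (half_lt_self hd)
      convert h1 using 1
      ext n
      rcases Nat.even_or_odd n with hn | hn
      · simp [hn, hn.neg_one_pow]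
      · have hn0 : n ≠ 0 := hn.pos.ne'
        simp only [Set.mem_sdiff, Set.mem_singleton_iff, Set.mem_ofPred_eq, hn, hn.neg_one_pow, hn0]
        norm_num
  · rintro ⟨hN0, he, ho⟩
    refine dense_monomialSpan_of_forall_mem fun m => ?_
    rcases Nat.even_or_odd m with hm | hm
    · rcases Nat.eq_zero_or_pos m with rfl | hm0
      · exact Submodule.le_topologicalClosure _ (Submodule.subset_span ⟨0, hN0, rfl⟩)
      · exact monomialOn_mem_of_even he a b hm0 hm
    · exact monomialOn_mem_of_odd ho a b hm

theorem theorem5p2 (g : C(ℝ, ℝ)) (hg : HasEntireExtension g)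
    (Λ : Set ℝ) (hΛ : ∃ t : ℝ, AccPt t (Filter.principal Λ))
    (a b : ℝ) (hab : a < b) :
    (Set.Icc a b ⊆ Set.Ioi 0 ∨ Set.Icc a b ⊆ Set.Iio 0 →
      (Dense (dilateSpan g Λ a b : Set C(Set.Icc a b, ℝ)) ↔
        ReciprocalSumDiverges (derivSupport g \ {0}))) ∧
    (a = 0 ∨ b = 0 →
      (Dense (dilateSpan g Λ a b : Set C(Set.Icc a b, ℝ)) ↔
        0 ∈ derivSupport g ∧ ReciprocalSumDiverges (derivSupport g \ {0}))) ∧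
    (a < 0 ∧ 0 < b →
      (Dense (dilateSpan g Λ a b : Set C(Set.Icc a b, ℝ)) ↔
        0 ∈ derivSupport g ∧
        ReciprocalSumDiverges {n | n ∈ derivSupport g \ {0} ∧ Even n} ∧
        ReciprocalSumDiverges {n | n ∈ derivSupport g ∧ Odd n})) := by
  rw [hg.dense_dilateSpan_iff hΛ]
  refine ⟨fun h => ?_, fun h => dense_monomialSpan_iff_of_endpoint_zero hab h,
    fun h => dense_monomialSpan_iff_of_zero_mem_Ioo h.1 h.2⟩
  exact dense_monomialSpan_iff_of_zero_notMem hab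
    (h.imp (fun h => h (Set.left_mem_Icc.2 hab.le)) (fun h => h (Set.right_mem_Icc.2 hab.le)))
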